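/- Let $1<\alpha<2$, $\beta\in[-1,1]$, $\sigma>0$, and write $S_\alpha(s,\beta,0)$ for the zero-mean $\alpha$-stable law with characteristic function $\theta\mapsto\exp\{-s^\alpha|\theta|^\alpha(1-i\beta\,\mathrm{sign}(\theta)\tan(\pi\alpha/2))\}$. Consider a network with links $1,\dots,L$ and routes $1,\dots,\mathcal J$; let $A_\ell\subset\{1,\dots,\mathcal J\}$ be the set of routes that use link $\ell$, let $A=(1_{A_\ell}(j))_{\ell,j}$ be the $L\times\mathcal J$ routing matrix, and let $r(1),\dots,r(\mathcal J)>0$. Let $\Lambda_\alpha^{(j)}=\{\Lambda^{(j)}_\alpha(t)\}_{t\ge0}$, $1\le j\le\mathcal J$, be i.i.d. Lévy $\alpha$-stable motions, that is, processes started at $0$ with independent increments such that $\Lambda_\alpha^{(j)}(t)-\Lambda_\alpha^{(j)}(s)\sim S_\alpha(\sigma(t-s)^{1/\alpha},\beta,0)$ for $0\le s\le t$, and put $\vec\Lambda_\alpha(t)=(r(j)\Lambda_\alpha^{(j)}(t))_{1\le j\le\mathcal J}$. (The process $\{A\vec\Lambda_\alpha(t)\}_{t\ge0}$ is the slow-regime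 limit of the cumulative traffic on the links.) Let $E=\{1,\dots,\mathcal J\}$ with the counting measure $\mu$, and let $M_\alpha$ be an $\alpha$-stable random measure on $\mathbb R\times E$ with control measure $m=\sigma^\alpha\,dx\times\mu(du)$, constant skewness intensity $\beta$ and mean zero: an independently scattered, $\sigma$-additive random set function on the sets $B$ with $m(B)<\infty$, with $M_\alpha(B)\sim S_\alpha(m(B)^{1/\alpha},\beta,0)$. For $f\in L^1(\mu)$ let $$\Lambda(f)=\int_{\mathbb R\times E}\bigl(1_{(-\infty,f(u)]}(x)-1_{(-\infty,0)}(x)\bigr)\,M_\alpha(dx,du)$$ be the functional Lévy stable motion. Then, in the sense of equality of all finite-dimensional distributions, $$\{A\vec\Lambda_\alpha(t)\}_{t\ge0}\ \stackrel{d}{=}\ \bigl\{(\Lambda(tf_\ell))_{1\le\ell\le L}\bigr\}_{t\ge0},\qquad f_\ell(u)=r(u)^{\alpha}\,1_{A_\ell}(u).$$ -/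

import Mathlib

open MeasureTheory ProbabilityTheory Filter Topology
open scoped NNReal ENNReal Matrix

noncomputable section

/-- `ν` is the `α`-stable law `S_α(σ, β, 0)` on `ℝ` with scale `σ`, skewness `β` and shift `0`,
for `α ≠ 1`; its characteristic function is
`θ ↦ exp (-σ^α |θ|^α (1 - i β sign(θ) tan(π α / 2)))`. For `1 < α` the shift is the mean. -/
structure IsStableLaw (α σ β : ℝ) (ν : Measure ℝ) : Prop where
  isProbabilityMeasure : IsProbabilityMeasure ν
  charFun_eq : ∀ θ : ℝ, charFun ν θ =
    Complex.exp (-((σ ^ α * |θ| ^ α : ℝ) : ℂ) *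
      (1 - Complex.I * ((β * Real.sign θ * Real.tan (Real.pi * α / 2) : ℝ) : ℂ)))

/-- `X` is a Lévy `α`-stable motion with scale `σ` and skewness `β` (and zero shift): it starts
at `0`, has independent increments, and `X t - X s ∼ S_α(σ (t - s)^{1/α}, β, 0)` for `s ≤ t`. -/
structure IsLevyStableMotion {Ω : Type*} [MeasurableSpace Ω] (P : Measure Ω) (α σ β : ℝ)
    (X : ℝ≥0 → Ω → ℝ) : Prop where
  measurable : ∀ t, Measurable (X t)
  start : ∀ᵐ ω ∂P, X 0 ω = 0
  indep_increments : HasIndepIncrements X P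
  stable_increments : ∀ s t : ℝ≥0, s ≤ t →
    IsStableLaw α (σ * ((t : ℝ) - s) ^ (1 / α)) β (P.map (fun ω => X t ω - X s ω))

/-- `M` is an `α`-stable random measure on `S` with control measure `m`, constant skewness
intensity `β` and zero shift: an independently scattered, `σ`-additive random set function on the
measurable sets of finite control measure, with `M(A) ∼ S_α(m(A)^{1/α}, β, 0)`.
(The values of `M` on other sets are irrelevant.) -/
structure IsStableRandomMeasure {Ω S : Type*} [MeasurableSpace Ω] [MeasurableSpace S]
    (P : Measure Ω) (α β : ℝ) (m : Measure S) (M : Set S → Ω → ℝ) : Prop where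
  measurable : ∀ A, MeasurableSet A → m A < ∞ → Measurable (M A)
  stable : ∀ A, MeasurableSet A → m A < ∞ →
    IsStableLaw α ((m A).toReal ^ (1 / α)) β (P.map (M A))
  independently_scattered : ∀ (n : ℕ) (A : Fin n → Set S),
    (∀ i, MeasurableSet (A i)) → (∀ i, m (A i) < ∞) → Pairwise (Function.onFun Disjoint A) →
    iIndepFun (fun i => M (A i)) P
  sigma_additive : ∀ A : ℕ → Set S,
    (∀ i, MeasurableSet (A i)) → Pairwise (Function.onFun Disjoint A) → m (⋃ i, A i) < ∞ →
    ∀ᵐ ω ∂P, Tendsto (fun n => ∑ i ∈ Finset.range n, M (A i) ω) atTop (𝓝 (M (⋃ i, A i) ω))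

/-- The stochastic integral `∫ g dM = ∑ c · M {g = c}` of a simple function `g` (one with finitely
many values), the sum being over the values `c` of `g`; the value `c = 0` contributes nothing. -/
def simpleStochasticIntegral {Ω S : Type*} (M : Set S → Ω → ℝ) (g : S → ℝ) (ω : Ω) : ℝ :=
  ∑ᶠ c ∈ Set.range g, c * M (g ⁻¹' {c}) ω

/-- The integrand `(x, u) ↦ 1_{(-∞, f u]}(x) - 1_{(-∞, 0)}(x)`. It takes no values other than
`-1`, `0` and `1`, and is therefore a simple function for every measurable `f`. -/
def functionalLevyKernel {E : Type*} (f : E → ℝ) (p : ℝ × E) : ℝ :=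
  (Set.Iic (f p.2)).indicator 1 p.1 - (Set.Iio (0 : ℝ)).indicator 1 p.1

/-- The functional Lévy stable motion
`Λ(f) = ∫ (1_{(-∞, f(u)]}(x) - 1_{(-∞, 0)}(x)) M(dx, du)` built from the random measure `M`. -/
def functionalLevyStableMotion {Ω E : Type*} (M : Set (ℝ × E) → Ω → ℝ) (f : E → ℝ) : Ω → ℝ :=
  simpleStochasticIntegral M (functionalLevyKernel f)

/-- The routing matrix: the entry at `(ℓ, j)` is `1` if the route `j` uses the link `ℓ`, that is
`j ∈ R ℓ`, and `0` otherwise. -/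
def routingMatrix {J L : ℕ} (R : Fin L → Set (Fin J)) : Matrix (Fin L) (Fin J) ℝ :=
  Matrix.of fun ℓ j => (R ℓ).indicator 1 j

/-- Equality of all finite-dimensional distributions of two processes indexed by `T`, possibly on
different probability spaces. -/
def EqualFDD {Ω Ω' T V : Type*} [MeasurableSpace Ω] [MeasurableSpace Ω'] [MeasurableSpace V]
    (P : Measure Ω) (P' : Measure Ω') (Y : T → Ω → V) (Z : T → Ω' → V) : Prop :=
  ∀ I : Finset T,
    IdentDistrib (fun ω (t : I) => Y t ω) (fun ω (t : I) => Z t ω) P P'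

end

/-! For `f ≥ 0` the kernel is the indicator of `0 ≤ x ≤ f u`, so `Λ(t f_ℓ)` is the `M`-mass of the
strips `[0, t r(j)^α]` over the routes `j` on link `ℓ`, up to a null set. Along a grid `τ`
containing the chosen times, these strips split into disjoint blocks `(τ_k r(j)^α, τ_{k+1} r(j)^α] ×
{j}`. Block masses are independent and stable with scale `(σ^α (τ_{k+1} - τ_k) r(j)^α)^{1/α} = r(j)
σ (τ_{k+1} - τ_k)^{1/α}`, exactly the scale of the increment of `r(j) Λ^{(j)}`; this explains the
power `r^α`. The two families thus have the same joint law (`identDistrib_increments`), and each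
process is almost surely the same linear image of its family (`routingMatrix_mulVec_ae_eq`,
`functionalLevyStableMotion_ae_eq_sum`). -/

namespace IsStableLaw

theorem measure_eq {α σ β : ℝ} {ν ν' : Measure ℝ} (h : IsStableLaw α σ β ν)
    (h' : IsStableLaw α σ β ν') : ν = ν' := by
  have := h.isProbabilityMeasure
  have := h'.isProbabilityMeasure
  refine Measure.ext_of_charFun (funext fun θ => ?_)
  rw [h.charFun_eq, h'.charFun_eq]

theorem eq_dirac {α β : ℝ} (hα : α ≠ 0) {ν : Measure ℝ} (h : IsStableLaw α 0 β ν) :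
    ν = Measure.dirac 0 := by
  have := h.isProbabilityMeasure
  refine Measure.ext_of_charFun (funext fun θ => ?_)
  rw [h.charFun_eq, charFun_dirac]
  simp [Real.zero_rpow hα]

theorem map_const_mul {α σ β c : ℝ} (hσ : 0 ≤ σ) (hc : 0 < c) {ν : Measure ℝ}
    (h : IsStableLaw α σ β ν) : IsStableLaw α (c * σ) β (ν.map (c * ·)) := by
  have := h.isProbabilityMeasure
  refine ⟨Measure.isProbabilityMeasure_map (by fun_prop), fun θ => ?_⟩
  rw [charFun_map_mul, h.charFun_eq, abs_mul, abs_of_pos hc,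
    Real.mul_rpow hc.le (abs_nonneg θ), Real.mul_rpow hc.le hσ]
  have hs : Real.sign (c * θ) = Real.sign θ := by
    rcases lt_trichotomy θ 0 with hθ | rfl | hθ
    · rw [Real.sign_of_neg hθ, Real.sign_of_neg (mul_neg_of_pos_of_neg hc hθ)]
    · simp
    · rw [Real.sign_of_pos hθ, Real.sign_of_pos (mul_pos hc hθ)]
  rw [hs, show σ ^ α * (c ^ α * |θ| ^ α) = c ^ α * σ ^ α * |θ| ^ α by ring]

end IsStableLaw

/-! ### Almost sure finite additivity and independence of stable random measures -/

namespace IsStableRandomMeasure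

variable {Ω S : Type*} [MeasurableSpace Ω] [MeasurableSpace S] {P : Measure Ω}
  {α β : ℝ} {m : Measure S} {M : Set S → Ω → ℝ}

theorem ae_eq_zero_of_null (hM : IsStableRandomMeasure P α β m M) (hα : 0 < α) {A : Set S}
    (hA : MeasurableSet A) (h0 : m A = 0) : M A =ᵐ[P] 0 := by
  have hfin : m A < ∞ := by simp [h0]
  have h := hM.stable A hA hfin
  rw [h0, ENNReal.toReal_zero, Real.zero_rpow (by positivity)] at h
  have hd := h.eq_dirac hα.ne'
  have : ∀ᵐ x ∂(P.map (M A)), x = 0 := by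
    rw [hd]
    exact (ae_dirac_iff (measurableSet_singleton 0)).2 rfl
  exact ae_of_ae_map (hM.measurable A hA hfin).aemeasurable this

theorem union_ae_eq (hM : IsStableRandomMeasure P α β m M) (hα : 0 < α) {A B : Set S}
    (hA : MeasurableSet A) (hB : MeasurableSet B) (hAB : Disjoint A B)
    (hA' : m A < ∞) (hB' : m B < ∞) : M (A ∪ B) =ᵐ[P] M A + M B := by
  -- Padding with empty sets, whose mass is almost surely `0`, makes the partial sums constant from
  -- index `2` on.
  let C : ℕ → Set S := fun n => if n = 0 then A else if n = 1 then B else ∅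
  have hC0 : C 0 = A := rfl
  have hC1 : C 1 = B := rfl
  have hC2 : ∀ n, 2 ≤ n → C n = ∅ := fun n hn => by
    simp [C, show n ≠ 0 by omega, show n ≠ 1 by omega]
  have hU : ⋃ i, C i = A ∪ B := by
    ext x
    simp only [Set.mem_iUnion, Set.mem_union]
    constructor
    · rintro ⟨i, hi⟩
      match i, hi with
      | 0, hi => exact Or.inl hi
      | 1, hi => exact Or.inr hi
      | n + 2, hi => rw [hC2 _ (by omega)] at hi; exact hi.elim
    · rintro (h | h)
      · exact ⟨0, h⟩
      · exact ⟨1, h⟩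
  have hCm : ∀ i, MeasurableSet (C i) := fun i => by
    simp only [C]; split_ifs <;> simp [hA, hB]
  have hCd : Pairwise (Function.onFun Disjoint C) := fun i j hij => by
    simp only [Function.onFun, C]
    split_ifs <;> first | omega | simp [hAB.symm]
  have hfin : m (⋃ i, C i) < ∞ := by
    rw [hU]; exact (measure_union_le A B).trans_lt (ENNReal.add_lt_top.2 ⟨hA', hB'⟩)
  filter_upwards [hM.sigma_additive C hCm hCd hfin,
    hM.ae_eq_zero_of_null hα MeasurableSet.empty measure_empty] with ω hω h0
  rw [hU] at hω
  refine tendsto_nhds_unique hω (tendsto_const_nhds.congr' ?_)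
  filter_upwards [eventually_ge_atTop 2] with n hn
  obtain ⟨k, rfl⟩ := Nat.exists_eq_add_of_le hn
  rw [Finset.sum_range_add, Finset.sum_eq_zero (s := Finset.range k)]
  · simp [Finset.sum_range_succ, hC0, hC1]
  · intro i _
    rw [hC2 _ (by omega)]
    exact h0

/-- Both masses agree almost surely with that of `A ∩ B`, since the two differences are null and
carry zero mass. -/
theorem ae_eq_of_ae_eq (hM : IsStableRandomMeasure P α β m M) (hα : 0 < α) {A B : Set S}
    (hA : MeasurableSet A) (hB : MeasurableSet B) (hA' : m A < ∞) (hAB : A =ᵐ[m] B) :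
    M A =ᵐ[P] M B := by
  have key : ∀ {A B : Set S}, MeasurableSet A → MeasurableSet B → m A < ∞ → A =ᵐ[m] B →
      M A =ᵐ[P] M (A ∩ B) := by
    intro A B hA hB hA' hAB
    have hd : m (A \ B) = 0 := (ae_eq_set.1 hAB).1
    have h := hM.union_ae_eq hα (hA.inter hB) (hA.diff hB) Set.disjoint_sdiff_inter.symm
      ((measure_mono Set.inter_subset_left).trans_lt hA') (by simp [hd])
    rw [Set.inter_union_sdiff] at h
    filter_upwards [h, hM.ae_eq_zero_of_null hα (hA.diff hB) hd] with ω h1 h2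
    rw [h1, Pi.add_apply, h2, Pi.zero_apply, add_zero]
  have h2 := key hB hA (measure_congr hAB ▸ hA') hAB.symm
  rw [Set.inter_comm] at h2
  exact (key hA hB hA' hAB).trans h2.symm

theorem biUnion_finset_ae_eq (hM : IsStableRandomMeasure P α β m M) (hα : 0 < α) {ι : Type*}
    {A : ι → Set S} (hA : ∀ i, MeasurableSet (A i)) (hA' : ∀ i, m (A i) < ∞)
    (hd : Pairwise (Function.onFun Disjoint A)) (s : Finset ι) :
    ∀ᵐ ω ∂P, M (⋃ i ∈ s, A i) ω = ∑ i ∈ s, M (A i) ω := by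
  classical
  induction s using Finset.induction_on with
  | empty =>
    filter_upwards [hM.ae_eq_zero_of_null hα MeasurableSet.empty measure_empty] with ω h
    simpa using h
  | insert a s ha ih =>
    have hU : m (⋃ i ∈ s, A i) < ∞ := measure_biUnion_lt_top s.finite_toSet fun i _ => hA' i
    have hdis : Disjoint (A a) (⋃ i ∈ s, A i) := by
      simp only [Set.disjoint_iUnion_right]
      exact fun i hi => hd fun h => ha (h ▸ hi)
    filter_upwards [ih, hM.union_ae_eq hα (hA a) (s.measurableSet_biUnion fun i _ => hA i) hdis
      (hA' a) hU] with ω h1 h2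
    rw [Finset.set_biUnion_insert, h2, Finset.sum_insert ha, Pi.add_apply, h1]

theorem iIndepFun_of_pairwise_disjoint (hM : IsStableRandomMeasure P α β m M) {ι : Type*}
    {A : ι → Set S} (hA : ∀ i, MeasurableSet (A i)) (hA' : ∀ i, m (A i) < ∞)
    (hd : Pairwise (Function.onFun Disjoint A)) : iIndepFun (fun i => M (A i)) P := by
  refine iIndepFun_iff_finset.2 fun s => ?_
  refine iIndepFun.of_precomp s.equivFin.symm.surjective ?_
  exact hM.independently_scattered _ (fun k => A (s.equivFin.symm k)) (fun _ => hA _)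
    (fun _ => hA' _) fun i j hij =>
      hd fun h => hij (s.equivFin.symm.injective (Subtype.ext h))

end IsStableRandomMeasure

/-! ### The integral as the mass of a subgraph -/

section Kernel

variable {E : Type*}

theorem functionalLevyKernel_of_nonneg {f : E → ℝ} (hf : ∀ u, 0 ≤ f u) (p : ℝ × E) :
    functionalLevyKernel f p = {q : ℝ × E | 0 ≤ q.1 ∧ q.1 ≤ f q.2}.indicator 1 p := by
  have := hf p.2
  simp only [functionalLevyKernel, Set.indicator_apply, Set.mem_Iic, Set.mem_Iio,
    Set.mem_ofPred_eq, Pi.one_apply]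
  split_ifs <;> grind

theorem functionalLevyKernel_preimage_one {f : E → ℝ} (hf : ∀ u, 0 ≤ f u) :
    functionalLevyKernel f ⁻¹' {1} = {q : ℝ × E | 0 ≤ q.1 ∧ q.1 ≤ f q.2} := by
  ext p
  simp [functionalLevyKernel_of_nonneg hf, Set.indicator_apply]

/-- For a nonnegative `f` the stochastic integral defining `Λ(f)` is the mass that the random
measure gives to the region under the graph of `f`. -/
theorem functionalLevyStableMotion_ae_eq [MeasurableSpace E] {Ω : Type*} [MeasurableSpace Ω]
    {P : Measure Ω} {α β : ℝ} (hα : 0 < α) {m : Measure (ℝ × E)} {M : Set (ℝ × E) → Ω → ℝ}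
    (hM : IsStableRandomMeasure P α β m M) {f : E → ℝ} (hf : ∀ u, 0 ≤ f u) :
    functionalLevyStableMotion M f =ᵐ[P] M {q : ℝ × E | 0 ≤ q.1 ∧ q.1 ≤ f q.2} := by
  filter_upwards [hM.ae_eq_zero_of_null hα MeasurableSet.empty measure_empty] with ω h0
  rw [functionalLevyStableMotion, simpleStochasticIntegral, finsum_eq_single _ 1]
  · by_cases h : (1 : ℝ) ∈ Set.range (functionalLevyKernel f)
    -- If `1` is not attained, the sum is zero and the subgraph is empty, so only `M ∅ = 0` almost
    -- surely is needed.
    · rw [functionalLevyKernel_preimage_one hf]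
      simp [h]
    · rw [← functionalLevyKernel_preimage_one hf, Set.preimage_singleton_eq_empty.2 h, h0]
      simp [h]
  · intro c hc
    by_cases hmem : c ∈ Set.range (functionalLevyKernel f)
    · obtain ⟨p, hp⟩ := hmem
      have hc0 : c = 0 := by
        rw [functionalLevyKernel_of_nonneg hf, Set.indicator_apply] at hp
        split_ifs at hp with h
        · exact (hc hp.symm).elim
        · exact hp.symm
      simp [hc0]
    · simp [hmem]

end Kernel

/-- Finitely many times are among the values of a nondecreasing sequence started at `0`. -/
theorem exists_monotone_seq_of_finset (I : Finset ℝ≥0) :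
    ∃ τ : ℕ → ℝ≥0, Monotone τ ∧ τ 0 = 0 ∧ ∀ t ∈ I, ∃ k, τ k = t := by
  classical
  obtain ⟨n, hn⟩ : ∃ n, (insert 0 I).card = n + 1 :=
    Nat.exists_eq_succ_of_ne_zero (Finset.card_ne_zero_of_mem (Finset.mem_insert_self 0 I))
  let e := (insert 0 I).orderEmbOfFin hn
  have he : ∀ t ∈ insert 0 I, ∃ i, e i = t := fun t ht => by
    have : t ∈ Set.range e := by
      rw [Finset.range_orderEmbOfFin]; exact ht
    exact this
  -- Past the largest time the sequence is constant, which only produces empty increments.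
  refine ⟨fun k => e ⟨min k n, by omega⟩, fun a b hab => e.monotone ?_, ?_, fun t ht => ?_⟩
  · exact Fin.mk_le_mk.2 (min_le_min_right n hab)
  · obtain ⟨i, hi⟩ := he 0 (Finset.mem_insert_self 0 I)
    refine le_antisymm ?_ (zero_le)
    rw [← hi]
    exact e.monotone (Fin.mk_le_mk.2 (by simp))
  · obtain ⟨i, hi⟩ := he t (Finset.mem_insert_of_mem ht)
    refine ⟨i, ?_⟩
    rw [← hi]
    exact congrArg e (Fin.ext (min_eq_left (Nat.lt_succ_iff.1 i.2)))

/-! ### Matching the increments of both processes -/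

section Increments

variable {Ω Ω' : Type*} [MeasurableSpace Ω] [MeasurableSpace Ω'] {P : Measure Ω}
  {P' : Measure Ω'} {α β σ : ℝ} {J L : ℕ} {r : Fin J → ℝ} {τ : ℕ → ℝ≥0}

/-- The block of `ℝ × E` over the route `j` whose `M`-mass is the `k`-th increment of the
functional Lévy stable motion. -/
def incrementBlock (α : ℝ) (r : Fin J → ℝ) (τ : ℕ → ℝ≥0) (p : Fin J × ℕ) : Set (ℝ × Fin J) :=
  Set.Ioc ((τ p.2 : ℝ) * r p.1 ^ α) ((τ (p.2 + 1) : ℝ) * r p.1 ^ α) ×ˢ {p.1}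

theorem monotone_coe_mul (hτ : Monotone τ) {c : ℝ} (hc : 0 ≤ c) :
    Monotone fun k => (τ k : ℝ) * c := fun _ _ hab =>
  mul_le_mul_of_nonneg_right (NNReal.coe_le_coe.2 (hτ hab)) hc

theorem measurableSet_incrementBlock (p : Fin J × ℕ) :
    MeasurableSet (incrementBlock α r τ p) :=
  measurableSet_Ioc.prod (measurableSet_singleton _)

theorem pairwise_disjoint_incrementBlock (hr : ∀ j, 0 < r j) (hτ : Monotone τ) :
    Pairwise (Function.onFun Disjoint (incrementBlock α r τ)) := by
  rintro ⟨j, k⟩ ⟨j', k'⟩ hne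
  simp only [Function.onFun, incrementBlock]
  by_cases hj : j = j'
  · subst hj
    have hk : k ≠ k' := fun h => hne (by rw [h])
    have hd := (monotone_coe_mul hτ
      (Real.rpow_nonneg (hr j).le α)).pairwise_disjoint_on_Ioc_succ hk
    exact Set.Disjoint.set_prod_left hd _ _
  · exact Set.Disjoint.set_prod_right (Set.disjoint_singleton.2 hj) _ _

theorem measure_incrementBlock (p : Fin J × ℕ) :
    (ENNReal.ofReal (σ ^ α) • (volume : Measure ℝ).prod (Measure.count : Measure (Fin J)))
      (incrementBlock α r τ p) =
      ENNReal.ofReal (σ ^ α) * ENNReal.ofReal (((τ (p.2 + 1) : ℝ) - τ p.2) * r p.1 ^ α) := by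
  rw [Measure.smul_apply, incrementBlock, Measure.prod_prod, Measure.count_singleton,
    Real.volume_Ioc, smul_eq_mul, mul_one, sub_mul]

theorem identDistrib_increments [IsProbabilityMeasure P] (hα : 0 < α) (hσ : 0 < σ)
    (hr : ∀ j, 0 < r j) (hτ : Monotone τ)
    {X : Fin J → ℝ≥0 → Ω → ℝ} (hX : ∀ j, IsLevyStableMotion P α σ β (X j))
    (hindep : iIndepFun (fun (j : Fin J) (ω : Ω) (t : ℝ≥0) => X j t ω) P)
    {M : Set (ℝ × Fin J) → Ω' → ℝ}
    (hM : IsStableRandomMeasure P' α β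
      (ENNReal.ofReal (σ ^ α) •
        (volume : Measure ℝ).prod (Measure.count : Measure (Fin J))) M) :
    IdentDistrib
      (fun ω (p : Fin J × ℕ) => r p.1 * (X p.1 (τ (p.2 + 1)) ω - X p.1 (τ p.2) ω))
      (fun ω p => M (incrementBlock α r τ p) ω) P P' := by
  have hmX : ∀ j t, Measurable (X j t) := fun j => (hX j).measurable
  have hfin : ∀ p, (ENNReal.ofReal (σ ^ α) • (volume : Measure ℝ).prod
      (Measure.count : Measure (Fin J))) (incrementBlock α r τ p) < ∞ := fun p => by
    rw [measure_incrementBlock]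
    exact ENNReal.mul_lt_top ENNReal.ofReal_lt_top ENNReal.ofReal_lt_top
  refine IdentDistrib.pi (fun p => ?_) ?_ (hM.iIndepFun_of_pairwise_disjoint
    measurableSet_incrementBlock hfin (pairwise_disjoint_incrementBlock hr hτ))
  · refine ⟨by fun_prop, (hM.measurable _ (measurableSet_incrementBlock p) (hfin p)).aemeasurable,
      ?_⟩
    have hle : 0 ≤ (τ (p.2 + 1) : ℝ) - τ p.2 :=
      sub_nonneg.2 (NNReal.coe_le_coe.2 (hτ (Nat.le_succ _)))
    have h1 := ((hX p.1).stable_increments _ _ (hτ (Nat.le_succ p.2))).map_const_mul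
      (mul_nonneg hσ.le (Real.rpow_nonneg hle _)) (hr p.1)
    rw [Measure.map_map (by fun_prop) (by fun_prop)] at h1
    have h2 := hM.stable _ (measurableSet_incrementBlock p) (hfin p)
    have hscale : r p.1 * (σ * ((τ (p.2 + 1) : ℝ) - τ p.2) ^ (1 / α)) =
        (ENNReal.ofReal (σ ^ α) *
          ENNReal.ofReal (((τ (p.2 + 1) : ℝ) - τ p.2) * r p.1 ^ α)).toReal ^ (1 / α) := by
      have hrα := Real.rpow_nonneg (hr p.1).le α
      have hσα := Real.rpow_nonneg hσ.le α
      rw [ENNReal.toReal_mul, ENNReal.toReal_ofReal hσα,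
        ENNReal.toReal_ofReal (mul_nonneg hle hrα),
        Real.mul_rpow hσα (mul_nonneg hle hrα), Real.mul_rpow hle hrα, one_div,
        Real.rpow_rpow_inv hσ.le hα.ne', Real.rpow_rpow_inv (hr p.1).le hα.ne']
      ring
    rw [measure_incrementBlock, ← hscale] at h2
    exact h1.measure_eq h2
  -- Independence over pairs `(j, k)` combines independence between routes with independence of the
  -- increments within each route.
  · refine iIndepFun_uncurry'
      (X := fun j k ω => r j * (X j (τ (k + 1)) ω - X j (τ k) ω)) (by fun_prop) ?_ fun j => ?_
    · exact hindep.comp (fun j x k => r j * (x (τ (k + 1)) - x (τ k))) (by fun_prop)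
    · exact ((hX j).indep_increments.nat hτ).comp (fun _ x => r j * x) (by fun_prop)

theorem routingMatrix_mulVec_ae_eq {X : Fin J → ℝ≥0 → Ω → ℝ}
    (hX : ∀ j, IsLevyStableMotion P α σ β (X j)) (R : Fin L → Set (Fin J)) (h0 : τ 0 = 0)
    (k : ℕ) :
    ∀ᵐ ω ∂P, routingMatrix R *ᵥ (fun j => r j * X j (τ k) ω) =
      routingMatrix R *ᵥ fun j =>
        ∑ i ∈ Finset.range k, r j * (X j (τ (i + 1)) ω - X j (τ i) ω) := by
  filter_upwards [ae_all_iff.2 fun j => (hX j).start] with ω hω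
  congr 1
  ext j
  rw [← Finset.mul_sum, Finset.sum_range_sub fun i => X j (τ i) ω, h0, hω, sub_zero]

/-- The subgraph contains its boundary `x = 0`, which the left-open blocks omit. This slice is null,
and it is all that the subgraph has over routes outside `R`. -/
theorem subgraph_ae_eq_biUnion_incrementBlock (R : Set (Fin J))
    [DecidablePred (· ∈ R)] (hr : ∀ j, 0 < r j) (hτ : Monotone τ) (h0 : τ 0 = 0) (k : ℕ) :
    {q : ℝ × Fin J | 0 ≤ q.1 ∧ q.1 ≤ (τ k : ℝ) * (r q.2 ^ α * R.indicator 1 q.2)}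
      =ᵐ[ENNReal.ofReal (σ ^ α) • (volume : Measure ℝ).prod (Measure.count : Measure (Fin J))]
    (⋃ p ∈ (Finset.univ.filter (· ∈ R)) ×ˢ Finset.range k, incrementBlock α r τ p :
      Set (ℝ × Fin J)) := by
  have hnull : ∀ᵐ q ∂(ENNReal.ofReal (σ ^ α) •
      (volume : Measure ℝ).prod (Measure.count : Measure (Fin J))), q.1 ≠ 0 := by
    refine Measure.ae_smul_measure ?_ _
    have : {q : ℝ × Fin J | ¬ q.1 ≠ 0} = {0} ×ˢ Set.univ := by
      ext q; simp
    rw [ae_iff, this, Measure.prod_prod]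
    simp
  filter_upwards [hnull] with q hq
  refine propext ?_
  change (0 ≤ q.1 ∧ q.1 ≤ _) ↔ q ∈ ⋃ p ∈ _, _
  have hU := (monotone_coe_mul hτ (Real.rpow_nonneg (hr q.2).le α)).biUnion_Ico_Ioc_map_succ 0 k
  have hU' := Set.ext_iff.1 hU q.1
  simp only [Set.mem_iUnion, Set.mem_Ioc, h0, Order.succ_eq_add_one] at hU'
  simp only [Set.mem_iUnion, Finset.mem_product, Finset.mem_filter, Finset.mem_univ, true_and,
    Finset.mem_range, incrementBlock, Set.mem_prod, Set.mem_singleton_iff, Prod.exists,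
    Set.mem_Ioc]
  by_cases hR : q.2 ∈ R
  · rw [Set.indicator_of_mem hR, Pi.one_apply, mul_one]
    constructor
    · rintro ⟨h1, h2⟩
      obtain ⟨i, hi, h3⟩ := hU'.2 ⟨by simpa using lt_of_le_of_ne h1 hq.symm, h2⟩
      exact ⟨q.2, i, ⟨hR, hi.2⟩, h3, rfl⟩
    · rintro ⟨j, i, ⟨_, hi⟩, h3, rfl⟩
      obtain ⟨h1, h2⟩ := hU'.1 ⟨i, ⟨Nat.zero_le _, hi⟩, h3⟩
      exact ⟨by simpa using h1.le, h2⟩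
  · rw [Set.indicator_of_notMem hR, mul_zero, mul_zero]
    constructor
    · rintro ⟨h1, h2⟩
      exact (hq (le_antisymm h2 h1)).elim
    · rintro ⟨j, i, ⟨hj, _⟩, _, rfl⟩
      exact (hR hj).elim

theorem measurableSet_subgraph (f : Fin J → ℝ) :
    MeasurableSet {q : ℝ × Fin J | 0 ≤ q.1 ∧ q.1 ≤ f q.2} :=
  (measurableSet_le measurable_const measurable_fst).inter
    (measurableSet_le measurable_fst ((measurable_of_finite f).comp measurable_snd))

theorem functionalLevyStableMotion_ae_eq_sum (hα : 0 < α) (hr : ∀ j, 0 < r j)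
    (hτ : Monotone τ) (h0 : τ 0 = 0) {M : Set (ℝ × Fin J) → Ω' → ℝ}
    (hM : IsStableRandomMeasure P' α β
      (ENNReal.ofReal (σ ^ α) •
        (volume : Measure ℝ).prod (Measure.count : Measure (Fin J))) M)
    (R : Fin L → Set (Fin J)) (k : ℕ) :
    ∀ᵐ ω ∂P', (fun ℓ => functionalLevyStableMotion M
        (fun u => (τ k : ℝ) * (r u ^ α * (R ℓ).indicator 1 u)) ω) =
      routingMatrix R *ᵥ fun j =>
        ∑ i ∈ Finset.range k, M (incrementBlock α r τ (j, i)) ω := by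
  classical
  suffices h : ∀ ℓ, ∀ᵐ ω ∂P', functionalLevyStableMotion M
        (fun u => (τ k : ℝ) * (r u ^ α * (R ℓ).indicator 1 u)) ω =
      (routingMatrix R *ᵥ fun j =>
        ∑ i ∈ Finset.range k, M (incrementBlock α r τ (j, i)) ω) ℓ by
    filter_upwards [ae_all_iff.2 h] with ω hω using funext hω
  intro ℓ
  have hfin : ∀ p, (ENNReal.ofReal (σ ^ α) • (volume : Measure ℝ).prod
      (Measure.count : Measure (Fin J))) (incrementBlock α r τ p) < ∞ := fun p => by
    rw [measure_incrementBlock]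
    exact ENNReal.mul_lt_top ENNReal.ofReal_lt_top ENNReal.ofReal_lt_top
  have hnn : ∀ u, 0 ≤ (τ k : ℝ) * (r u ^ α * (R ℓ).indicator 1 u) := fun u =>
    mul_nonneg (τ k).coe_nonneg (mul_nonneg (Real.rpow_nonneg (hr u).le α)
      (Set.indicator_nonneg (fun _ _ => zero_le_one) u))
  have hae := subgraph_ae_eq_biUnion_incrementBlock (α := α) (σ := σ) (R ℓ) hr hτ h0 k
  have hU := measure_biUnion_lt_top
    ((Finset.univ.filter (· ∈ R ℓ)) ×ˢ Finset.range k).finite_toSet fun p _ => hfin p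
  filter_upwards [functionalLevyStableMotion_ae_eq hα hM hnn,
    hM.ae_eq_of_ae_eq hα (measurableSet_subgraph fun u => (τ k : ℝ) * (r u ^ α * (R ℓ).indicator 1 u))
      (Finset.measurableSet_biUnion _ fun p _ => measurableSet_incrementBlock p)
      ((measure_congr hae).trans_lt hU) hae,
    hM.biUnion_finset_ae_eq hα measurableSet_incrementBlock hfin
      (pairwise_disjoint_incrementBlock hr hτ)
      ((Finset.univ.filter (· ∈ R ℓ)) ×ˢ Finset.range k)] with ω h1 h2 h3
  rw [h1, h2, h3, Finset.sum_product, Finset.sum_filter]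
  simp [Matrix.mulVec, dotProduct, routingMatrix, Set.indicator_apply]

end Increments

theorem propositionp {Ω Ω' : Type*} [MeasurableSpace Ω] [MeasurableSpace Ω']
    (P : Measure Ω) [IsProbabilityMeasure P] (P' : Measure Ω') [IsProbabilityMeasure P']
    (α β σ : ℝ) (hα₁ : 1 < α) (hα₂ : α < 2) (hβ : β ∈ Set.Icc (-1 : ℝ) 1) (hσ : 0 < σ)
    {J L : ℕ} (R : Fin L → Set (Fin J)) (r : Fin J → ℝ) (hr : ∀ j, 0 < r j)
    (X : Fin J → ℝ≥0 → Ω → ℝ) (hX : ∀ j, IsLevyStableMotion P α σ β (X j))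
    (hindep : iIndepFun (fun (j : Fin J) (ω : Ω) (t : ℝ≥0) => X j t ω) P)
    (M : Set (ℝ × Fin J) → Ω' → ℝ)
    (hM : IsStableRandomMeasure P' α β
      (ENNReal.ofReal (σ ^ α) •
        (volume : Measure ℝ).prod (Measure.count : Measure (Fin J))) M) :
    EqualFDD P P'
      (fun (t : ℝ≥0) (ω : Ω) => routingMatrix R *ᵥ (fun j => r j * X j t ω))
      (fun (t : ℝ≥0) (ω : Ω') (ℓ : Fin L) =>
        functionalLevyStableMotion M
          (fun u => (t : ℝ) * (r u ^ α * (R ℓ).indicator 1 u)) ω) := by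
  have hα : 0 < α := by linarith
  intro I
  obtain ⟨τ, hτ, h0, hI⟩ := exists_monotone_seq_of_finset I
  choose k hk using fun t : I => hI t t.2
  -- The common linear map: sum the increments up to each time on every route, then apply the
  -- routing matrix.
  let Φ : (Fin J × ℕ → ℝ) → I → Fin L → ℝ := fun x t =>
    routingMatrix R *ᵥ fun j => ∑ i ∈ Finset.range (k t), x (j, i)
  have hΦ : Measurable Φ := by
    refine measurable_pi_lambda _ fun t => measurable_pi_lambda _ fun ℓ => ?_
    simp only [Φ, Matrix.mulVec, dotProduct]
    fun_prop
  have hΦM := (identDistrib_increments hα hσ hr hτ hX hindep hM).comp hΦ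
  have hleft : (fun ω (t : I) => routingMatrix R *ᵥ (fun j => r j * X j t ω)) =ᵐ[P]
      fun ω => Φ fun p => r p.1 * (X p.1 (τ (p.2 + 1)) ω - X p.1 (τ p.2) ω) := by
    filter_upwards [ae_all_iff.2 fun t : I =>
      routingMatrix_mulVec_ae_eq (r := r) hX R h0 (k t)] with ω hω
    funext t
    rw [← hk t]
    exact hω t
  have hright : (fun ω (t : I) (ℓ : Fin L) => functionalLevyStableMotion M
        (fun u => ((t : ℝ≥0) : ℝ) * (r u ^ α * (R ℓ).indicator 1 u)) ω) =ᵐ[P']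
      fun ω => Φ fun p => M (incrementBlock α r τ p) ω := by
    filter_upwards [ae_all_iff.2 fun t : I =>
      functionalLevyStableMotion_ae_eq_sum hα hr hτ h0 hM R (k t)] with ω hω
    funext t
    rw [← hk t]
    exact hω t
  exact ((IdentDistrib.of_ae_eq (hΦM.aemeasurable_fst.congr hleft.symm) hleft).trans hΦM).trans
    (IdentDistrib.of_ae_eq hΦM.aemeasurable_snd hright.symm)
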